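/- Let $G=(V,\mathcal D,\mathcal B)$ be a finite acyclic directed mixed graph (directed edges $i\to j$, bidirected edges $i\leftrightarrow j$, no loops, no directed cycles; $i\to j$ and $i\leftrightarrow j$ may both be present). The linear Gaussian structural equation model on $G$ consists of the laws of the random vectors $X=(X_i)_{i\in V}$ with $$X_i=\sum_{j\to i}\lambda_{ji}X_j+\epsilon_i\quad(i\in V),\qquad \epsilon\sim N(0,\Omega),$$ where the real edge coefficients $\lambda_{ji}$ (for $j\to i$ in $\mathcal D$) are arbitrary, and $\Omega=(\omega_{ij})$ is any positive definite matrix with $\omega_{ij}=0$ whenever $i\ne j$ and $i\leftrightarrow j\notin\mathcal B$. Let $\Sigma=(\sigma_{ij})=\operatorname{Cov}(X)$. For $v,w\in V$ and $S\subseteq V\setminus\{v,w\}$ put $$\sigma_{vw\cdot S}=\sigma_{vw}-\Sigma_{vS}\Sigma_{SS}^{-1}\Sigma_{Sw},\qquad \beta_{vw\cdot S}=\frac{\sigma_{vw\cdot S}}{\sigma_{vv\cdot S}}.$$ For an edge $a\to b$ in $\mathcal D$, the coefficient $\lambda_{ab}$ is called regression identifiable if there is a set $S\subseteq V\setminus\{a,b\}$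 such that $\lambda_{ab}=\beta_{ab\cdot S}$ for all parameters $(\lambda,\Omega)$ of the model. Let $\mathrm{an}(b)$ be the set consisting of $b$ and all vertices with a directed path to $b$, and let $G_{\mathrm{an}(b)}$ be the induced subgraph of $G$ on $\mathrm{an}(b)$. Let $\mathrm{dis}_{\mathrm{an}(b)}(b)$ be the district of $b$ in $G_{\mathrm{an}(b)}$, i.e. the set of all vertices joined to $b$ by a (possibly trivial) path of bidirected edges in $G_{\mathrm{an}(b)}$, and let $$S(b)=\mathrm{pa}\big(\mathrm{dis}_{\mathrm{an}(b)}(b)\big)\cup\big(\mathrm{dis}_{\mathrm{an}(b)}(b)\setminus\{b\}\big)$$ be the Markov blanket of $b$ in $G_{\mathrm{an}(b)}$, where $\mathrm{pa}(D)$ is the set of all parents of elements of $D$. **Theorem.** Let $a\to b$ be a directed edge of $G$. Then $\lambda_{ab}$ is regression identifiable if and only if 1. $a\notin\mathrm{dis}_{\mathrm{an}(b)}(b)$, and 2. there is no directed edge $a\to d$ with $d\in\mathrm{dis}_{\mathrm{an}(b)}(b)\setminus\{b\}$. When these two conditions hold, $S(b)\setminus\{a\}\subseteq V\setminus\{a,b\}$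 and $\lambda_{ab}=\beta_{ab\cdot S(b)\setminus\{a\}}$ for all parameters of the model. -/

import Mathlib

open MeasureTheory ProbabilityTheory Matrix

/-- An acyclic directed mixed graph (ADMG) with vertex set `V`: directed edges `dir i j` (`i → j`),
bidirected edges `bidir i j` (`i ↔ j`), no loops and no directed cycles.
(A directed loop would be a directed cycle.) Both kinds of edges may join the same two vertices. -/
structure ADMG (V : Type*) where
  dir : V → V → Prop
  bidir : V → V → Prop
  bidir_symm : ∀ {i j : V}, bidir i j → bidir j i
  bidir_irrefl : ∀ i : V, ¬ bidir i i
  acyclic : ∀ i : V, ¬ Relation.TransGen dir i i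

namespace ADMG

variable {V : Type*}

/-- The set of parents of a vertex. -/
def parents (G : ADMG V) (v : V) : Set V := {u | G.dir u v}

/-- The set of parents of a set of vertices. -/
def parentsOf (G : ADMG V) (S : Set V) : Set V := ⋃ v ∈ S, G.parents v

/-- The ancestors of `v`: the vertex `v` itself and all `u` with a directed path from `u` to `v`. -/
def ancestors (G : ADMG V) (v : V) : Set V := {u | Relation.ReflTransGen G.dir u v}

/-- The induced subgraph on the vertex set `W`. -/
def induce (G : ADMG V) (W : Set V) : ADMG W where
  dir i j := G.dir i j
  bidir i j := G.bidir i j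
  bidir_symm h := G.bidir_symm h
  bidir_irrefl i := G.bidir_irrefl i
  acyclic i h := G.acyclic i (Relation.TransGen.lift Subtype.val (fun _ _ hij => hij) _ _ h)

/-- The district of `v`, that is, the maximal bidirected-connected set containing `v`: all vertices
joined to `v` by a (possibly trivial) bidirected path. -/
def district (G : ADMG V) (v : V) : Set V := {u | Relation.ReflTransGen G.bidir v u}

/-- The Markov blanket of `v`: the parents of the district of `v`, together with the district
without `v`. -/
def markovBlanket (G : ADMG V) (v : V) : Set V :=
  G.parentsOf (G.district v) ∪ (G.district v \ {v})

theorem mem_ancestors_self (G : ADMG V) (v : V) : v ∈ G.ancestors v :=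
  Relation.ReflTransGen.refl

/-- The district of `b` in the induced subgraph on the ancestors of `b`, as a set of vertices of the
whole graph. -/
def ancestralDistrict (G : ADMG V) (b : V) : Set V :=
  Subtype.val '' (G.induce (G.ancestors b)).district ⟨b, G.mem_ancestors_self b⟩

/-- The Markov blanket of `b` in the induced subgraph on the ancestors of `b`, as a set of vertices
of the whole graph. -/
def ancestralMarkovBlanket (G : ADMG V) (b : V) : Set V :=
  Subtype.val '' (G.induce (G.ancestors b)).markovBlanket ⟨b, G.mem_ancestors_self b⟩

/-- Parameters of a linear Gaussian structural equation model on `G`: edge coefficients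
`coeff i j` (of `i → j`), zero unless `i → j` is an edge, and a positive definite error covariance
matrix whose off-diagonal entries vanish unless `i ↔ j` is an edge. -/
structure SEMParameters [Fintype V] (G : ADMG V) where
  coeff : Matrix V V ℝ
  errorCov : Matrix V V ℝ
  coeff_eq_zero : ∀ i j, ¬ G.dir i j → coeff i j = 0
  errorCov_posDef : errorCov.PosDef
  errorCov_eq_zero : ∀ i j, i ≠ j → ¬ G.bidir i j → errorCov i j = 0

/-- `μ` is the law of a random vector `X` that satisfies the structural equations
`X i = ∑ j, coeff j i * X j + ε i` with `ε ~ N(0, errorCov)`: the residual vector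
`ε = X - coeffᵀ X` is centred Gaussian with covariance matrix `errorCov`. -/
def SEMParameters.IsLaw [Fintype V] [DecidableEq V] {G : ADMG V} (θ : G.SEMParameters)
    (μ : Measure (EuclideanSpace ℝ V)) : Prop :=
  μ.map (fun x : EuclideanSpace ℝ V =>
      WithLp.toLp 2 (fun i : V => x i - ∑ j : V, θ.coeff j i * x j))
    = multivariateGaussian 0 θ.errorCov

end ADMG

section Regression

variable {V : Type*} [Fintype V]

/-- The covariance matrix of a law on `ℝ^V`. -/
noncomputable def covMatrixOfLaw (μ : Measure (EuclideanSpace ℝ V)) : Matrix V V ℝ :=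
  Matrix.of fun i j => cov[fun x => x i, fun x => x j; μ]

/-- The partial covariance `σ_{vw·S} = σ_{vw} - Σ_{vS} Σ_{SS}⁻¹ Σ_{Sw}`. -/
noncomputable def partialCov [DecidableEq V] (C : Matrix V V ℝ) (v w : V) (S : Finset V) : ℝ :=
  C v w - (fun s : S => C v s) ⬝ᵥ
    ((C.submatrix (Subtype.val : S → V) (Subtype.val : S → V))⁻¹ *ᵥ fun s : S => C s w)

/-- The partial regression coefficient `β_{vw·S} = σ_{vw·S} / σ_{vv·S}`. -/
noncomputable def partialRegCoeff [DecidableEq V] (C : Matrix V V ℝ) (v w : V) (S : Finset V) : ℝ :=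
  partialCov C v w S / partialCov C v v S

end Regression

namespace ADMG

variable {V : Type*} [Fintype V] [DecidableEq V]

/-- The adjustment set `S ⊆ V \ {a, b}` identifies the coefficient of `a → b` by regression:
`λ_{ab} = β_{ab·S}` holds throughout the model, for all parameters. -/
def RegressionIdentifiesBy (G : ADMG V) (a b : V) (S : Finset V) : Prop :=
  a ∉ S ∧ b ∉ S ∧ ∀ (θ : G.SEMParameters) (μ : Measure (EuclideanSpace ℝ V)), θ.IsLaw μ →
    θ.coeff a b = partialRegCoeff (covMatrixOfLaw μ) a b S

/-- The coefficient of `a → b` is regression identifiable. -/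
def RegressionIdentifiable (G : ADMG V) (a b : V) : Prop :=
  ∃ S : Finset V, G.RegressionIdentifiesBy a b S

end ADMG

/-! Since `1 - Λ` is invertible by acyclicity, each parameter has exactly one law, and everything
reduces to Σ = (1-Λ)⁻ᵀ Ω (1-Λ)⁻¹.

Sufficiency. Let D be the ancestral district of b and z·ε the residual of ε_b regressed on the
errors of D \ {b}. Errors of ancestors outside D are uncorrelated with it as well, hence so is X_v
for every ancestor v ≠ b. In terms of X the residual is y·X with y = (1-Λ)z. This y lives on b and
its Markov blanket, y_b = 1, and the two conditions give y_a = -λ_ab, so y solves the normal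
equations.

Necessity. For each S there are parameters with λ_ab = 0 and σ_{ab·S} ≠ 0. Unit coefficients along a
forest lead each ancestor of b to a root in S ∪ {a, b}, and a root then carries the sum of the
errors of its class. Bidirected paths in D project to paths of roots starting at b. If a is
reachable in this way, errors correlated only along one such path make Σ tridiagonal on it.
Otherwise D contains a child d ≠ b of a, and the edge a → d supplies the last link from the root of
d to a. By `partialCov_ne_zero_of_path`, σ_{ab·S} = 0 would force the residual of X_a to have
coefficient zero at each path vertex in turn, including a, where it is 1. -/

theorem EuclideanSpace.continuous_toLp_mulVec {V : Type*} [Fintype V] (A : Matrix V V ℝ) :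
    Continuous fun x : EuclideanSpace ℝ V => WithLp.toLp 2 (A *ᵥ x.ofLp) :=
  (PiLp.continuous_toLp 2 _).comp
    (Continuous.matrix_mulVec continuous_const (PiLp.continuous_ofLp 2 _))

namespace ADMG

/-! ### Laws and covariance matrices of the model -/

section Model

variable {V : Type*} [Fintype V] (G : ADMG V)

theorem wellFounded_dir : WellFounded G.dir := by
  have : Std.Irrefl (Relation.TransGen G.dir) := ⟨G.acyclic⟩
  exact Subrelation.wf (fun h => Relation.TransGen.single h)
    (Finite.wellFounded_of_trans_of_irrefl (Relation.TransGen G.dir))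

theorem wellFounded_swap_dir : WellFounded (Function.swap G.dir) := by
  have : Std.Irrefl (Function.swap (Relation.TransGen G.dir)) := ⟨G.acyclic⟩
  have : IsTrans V (Function.swap (Relation.TransGen G.dir)) := ⟨fun _ _ _ h h' => h'.trans h⟩
  exact Subrelation.wf (r := Function.swap (Relation.TransGen G.dir))
    (fun h => Relation.TransGen.single h) (Finite.wellFounded_of_trans_of_irrefl _)

namespace SEMParameters

variable {G} [DecidableEq V] (θ : G.SEMParameters)

theorem injective_one_sub_coeff_mulVec :
    Function.Injective ((1 - θ.coeff) *ᵥ · : (V → ℝ) → V → ℝ) := by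
  intro x y hxy
  have h : ∀ u, x u - y u = ∑ v, θ.coeff u v * (x v - y v) := fun u => by
    have := congrFun hxy u
    simp only [sub_mulVec, one_mulVec, Pi.sub_apply] at this
    simp only [mulVec, dotProduct] at this
    simp only [mul_sub, Finset.sum_sub_distrib]
    linarith
  funext u
  -- Induction from children to parents: row u of Λ involves only children of u.
  refine sub_eq_zero.1 (G.wellFounded_swap_dir.induction (C := fun u => x u - y u = 0) u ?_)
  intro u ih
  rw [h u]
  refine Finset.sum_eq_zero fun v _ => ?_
  by_cases huv : G.dir u v
  · rw [ih v huv, mul_zero]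
  · rw [θ.coeff_eq_zero u v huv, zero_mul]

theorem isUnit_one_sub_coeff : IsUnit (1 - θ.coeff) :=
  mulVec_injective_iff_isUnit.1 θ.injective_one_sub_coeff_mulVec

theorem isUnit_det_one_sub_coeff : IsUnit (1 - θ.coeff).det :=
  (isUnit_iff_isUnit_det _).1 θ.isUnit_one_sub_coeff

/-- The covariance matrix `(1 - Λ)⁻ᵀ Ω (1 - Λ)⁻¹` of the model. -/
noncomputable def cov : Matrix V V ℝ :=
  ((1 - θ.coeff)⁻¹)ᵀ * θ.errorCov * (1 - θ.coeff)⁻¹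

theorem posDef_cov : θ.cov.PosDef := by
  have := θ.errorCov_posDef.conjTranspose_mul_mul_same (B := (1 - θ.coeff)⁻¹)
    (mulVec_injective_iff_isUnit.2 ((isUnit_nonsing_inv_iff).2 θ.isUnit_one_sub_coeff))
  simpa [cov, conjTranspose_eq_transpose_of_trivial] using this

theorem cov_mul_one_sub_coeff :
    θ.cov * (1 - θ.coeff) = ((1 - θ.coeff)⁻¹)ᵀ * θ.errorCov := by
  rw [cov, Matrix.mul_assoc, nonsing_inv_mul _ θ.isUnit_det_one_sub_coeff, Matrix.mul_one]

theorem one_sub_coeff_transpose_mul_cov_mul :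
    (1 - θ.coeff)ᵀ * (θ.cov * (1 - θ.coeff)) = θ.errorCov := by
  rw [cov_mul_one_sub_coeff, ← Matrix.mul_assoc, ← transpose_mul,
    nonsing_inv_mul _ θ.isUnit_det_one_sub_coeff, transpose_one, Matrix.one_mul]

theorem residual_eq (x : EuclideanSpace ℝ V) :
    (fun i : V => x i - ∑ j : V, θ.coeff j i * x j) = (1 - θ.coeff)ᵀ *ᵥ x.ofLp := by
  funext i
  rw [transpose_sub, transpose_one, sub_mulVec, one_mulVec]
  rfl

theorem isLaw_map :
    θ.IsLaw ((multivariateGaussian 0 θ.errorCov).map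
      fun x => WithLp.toLp 2 (((1 - θ.coeff)⁻¹)ᵀ *ᵥ x.ofLp)) := by
  simp only [IsLaw, residual_eq]
  rw [Measure.map_map (EuclideanSpace.continuous_toLp_mulVec _).measurable
    (EuclideanSpace.continuous_toLp_mulVec _).measurable]
  convert Measure.map_id
  funext x
  simp only [Function.comp_apply, mulVec_mulVec, ← transpose_mul,
    nonsing_inv_mul _ θ.isUnit_det_one_sub_coeff, transpose_one, one_mulVec, WithLp.toLp_ofLp,
    id_eq]

variable {θ}

theorem IsLaw.eq_map {μ : Measure (EuclideanSpace ℝ V)} (h : θ.IsLaw μ) :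
    μ = (multivariateGaussian 0 θ.errorCov).map
      fun x => WithLp.toLp 2 (((1 - θ.coeff)⁻¹)ᵀ *ᵥ x.ofLp) := by
  rw [IsLaw] at h
  simp only [residual_eq] at h
  rw [← h, Measure.map_map (EuclideanSpace.continuous_toLp_mulVec _).measurable
    (EuclideanSpace.continuous_toLp_mulVec _).measurable]
  convert Measure.map_id.symm
  funext x
  simp only [Function.comp_apply, mulVec_mulVec, ← transpose_mul,
    mul_nonsing_inv _ θ.isUnit_det_one_sub_coeff, transpose_one, one_mulVec, WithLp.toLp_ofLp,
    id_eq]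

theorem IsLaw.covMatrixOfLaw_eq {μ : Measure (EuclideanSpace ℝ V)} (h : θ.IsLaw μ) :
    covMatrixOfLaw μ = θ.cov := by
  have hm : ∀ k : V, MemLp (fun x : EuclideanSpace ℝ V => x k) 2
      (multivariateGaussian 0 θ.errorCov) := fun k => by
    have := (IsGaussian.memLp_two_id (μ := multivariateGaussian 0 θ.errorCov))
    exact (EuclideanSpace.proj (𝕜 := ℝ) k).comp_memLp' this
  ext i j
  rw [covMatrixOfLaw, of_apply, h.eq_map,
    covariance_map (by fun_prop) (by fun_prop)
      (EuclideanSpace.continuous_toLp_mulVec _).measurable.aemeasurable]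
  simp only [Function.comp_def, mulVec, dotProduct]
  rw [covariance_fun_sum_fun_sum (fun k => (hm k).const_mul _) (fun k => (hm k).const_mul _)]
  simp only [covariance_const_mul_left, covariance_const_mul_right,
    covariance_eval_multivariateGaussian θ.errorCov_posDef.posSemidef]
  simp only [cov, mul_apply, transpose_apply, Finset.sum_mul]
  rw [Finset.sum_comm]
  exact Finset.sum_congr rfl fun _ _ => Finset.sum_congr rfl fun _ _ => by ring

end SEMParameters

/-- Existence of a law for each parameter gives one direction, its uniqueness the other; measures
play no further role. -/
theorem regressionIdentifiesBy_iff [DecidableEq V] {G : ADMG V} {a b : V} {S : Finset V} :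
    G.RegressionIdentifiesBy a b S ↔ a ∉ S ∧ b ∉ S ∧
      ∀ θ : G.SEMParameters, θ.coeff a b = partialRegCoeff θ.cov a b S := by
  refine and_congr_right fun _ => and_congr_right fun _ => ⟨fun h θ => ?_, fun h θ μ hμ => ?_⟩
  · rw [h θ _ θ.isLaw_map, θ.isLaw_map.covMatrixOfLaw_eq]
  · rw [h θ, hμ.covMatrixOfLaw_eq]

end Model

end ADMG

/-! ### Partial covariances through regression residuals -/

section PartialCovariance

variable {V : Type*} [Fintype V] [DecidableEq V]

/-- The partial covariances given `S` are covariances with the residual of the regression on `S`. -/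
theorem exists_partialCov_eq_vecMul {C : Matrix V V ℝ} (hC : C.PosDef) {a : V} {S : Finset V}
    (ha : a ∉ S) :
    ∃ h : V → ℝ, h a = 1 ∧ (∀ v, v ≠ a → v ∉ S → h v = 0) ∧ (∀ s ∈ S, (h ᵥ* C) s = 0) ∧
      ∀ w, partialCov C a w S = (h ᵥ* C) w := by
  set CS := C.submatrix (Subtype.val : S → V) (Subtype.val : S → V) with hCS
  have hpd : CS.PosDef := hC.submatrix Subtype.val_injective
  have hu : IsUnit CS.det := (isUnit_iff_isUnit_det _).1 hpd.isUnit
  set k : S → ℝ := (fun s : S => C a s) ᵥ* CS⁻¹ with hk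
  have hval : ∀ w, ((fun v => if hv : v ∈ S then - k ⟨v, hv⟩ else if v = a then 1 else 0) ᵥ* C) w
      = C a w - k ⬝ᵥ fun s : S => C s w := fun w => by
    have hsplit : ∀ v, (if hv : v ∈ S then - k ⟨v, hv⟩ else if v = a then 1 else 0) * C v w
        = (if v = a then C v w else 0) - if hv : v ∈ S then k ⟨v, hv⟩ * C v w else 0 := fun v => by
      by_cases hv : v ∈ S
      · have : v ≠ a := fun h => ha (h ▸ hv)
        simp [hv, this]
      · by_cases hva : v = a <;> simp [hva, hv, ha]
    simp only [vecMul, dotProduct, hsplit, Finset.sum_sub_distrib, Finset.sum_ite_eq',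
      Finset.mem_univ, if_true]
    congr 1
    rw [← Finset.sum_subset (Finset.subset_univ S) (fun v _ hv => by simp [hv]),
      ← Finset.sum_coe_sort S]
    exact Finset.sum_congr rfl fun s _ => by simp
  refine ⟨fun v => if hv : v ∈ S then - k ⟨v, hv⟩ else if v = a then 1 else 0, ?_, ?_, ?_,
    fun w => ?_⟩
  · simp [ha]
  · intro v hv hvS
    simp [hv, hvS]
  · intro s hs
    rw [hval, sub_eq_zero]
    have : k ᵥ* CS = fun s : S => C a s := by
      rw [hk, vecMul_vecMul, nonsing_inv_mul _ hu, vecMul_one]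
    exact (congrFun this ⟨s, hs⟩).symm
  · rw [hval, partialCov, dotProduct_mulVec]

/-- For the residual vector h, σ_{aa·S} equals the quadratic form h·Ch. -/
theorem partialCov_self_pos {C : Matrix V V ℝ} (hC : C.PosDef) {a : V} {S : Finset V}
    (ha : a ∉ S) : 0 < partialCov C a a S := by
  obtain ⟨h, h1, h2, h3, h4⟩ := exists_partialCov_eq_vecMul hC ha
  have hh : h ≠ 0 := fun h0 => by simp [h0] at h1
  have hpos : 0 < h ⬝ᵥ C *ᵥ h := by simpa using hC.dotProduct_mulVec_pos hh
  rw [dotProduct_mulVec, dotProduct, Finset.sum_eq_single a] at hpos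
  · rwa [h1, mul_one, ← h4] at hpos
  · intro v _ hv
    by_cases hvS : v ∈ S
    · rw [h3 v hvS, zero_mul]
    · rw [h2 v hv hvS, mul_zero]
  · simp

/-- A regression coefficient read off from a vector that solves the normal equations. -/
theorem partialRegCoeff_eq_neg {C : Matrix V V ℝ} (hC : C.PosDef) {a b : V} {S : Finset V}
    (ha : a ∉ S) (hab : a ≠ b) {y : V → ℝ} (hy : ∀ v, v ≠ a → v ≠ b → v ∉ S → y v = 0)
    (hyb : y b = 1) (hya : (C *ᵥ y) a = 0) (hyS : ∀ s ∈ S, (C *ᵥ y) s = 0) :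
    partialRegCoeff C a b S = - y a := by
  obtain ⟨h, h1, h2, h3, h4⟩ := exists_partialCov_eq_vecMul hC ha
  have hz : h ⬝ᵥ C *ᵥ y = 0 := Finset.sum_eq_zero fun v _ => by
    by_cases hva : v = a
    · rw [hva, hya, mul_zero]
    · by_cases hvS : v ∈ S
      · rw [hyS v hvS, mul_zero]
      · rw [h2 v hva hvS, zero_mul]
  -- Moving C onto h leaves σ_{aa·S} y_a + σ_{ab·S} y_b = 0.
  rw [dotProduct_mulVec, dotProduct, Finset.sum_eq_add a b hab] at hz
  · rw [partialRegCoeff, div_eq_iff (partialCov_self_pos hC ha).ne', h4, h4]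
    rw [hyb] at hz
    linarith
  · intro v _ hv
    by_cases hvS : v ∈ S
    · rw [h3 v hvS, zero_mul]
    · rw [hy v hv.1 hv.2 hvS, mul_zero]
  · simp
  · simp

/-- The partial covariance of the end points of a path on which the covariance matrix is
tridiagonal does not vanish. -/
theorem partialCov_ne_zero_of_path {C : Matrix V V ℝ} (hC : C.PosDef) {a b : V} {S : Finset V}
    (ha : a ∉ S) (p : ℕ → V) (n : ℕ) (hp0 : p 0 = b) (hpn : p n = a)
    (hpS : ∀ i < n, p i = b ∨ p i ∈ S) (hne : ∀ i < n, C (p (i + 1)) (p i) ≠ 0)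
    (hzero : ∀ i < n, ∀ r, (r = a ∨ r ∈ S) → r ≠ p (i + 1) → (∀ j ≤ i, r ≠ p j) →
      C r (p i) = 0) (hab : a ≠ b) (hb : b ∉ S) :
    partialCov C a b S ≠ 0 := by
  intro h0
  obtain ⟨h, h1, h2, h3, h4⟩ := exists_partialCov_eq_vecMul hC ha
  -- Column p i of h C = 0 has p (i + 1) as its only unknown, the earlier path entries of h being
  -- zero already.
  have key : ∀ i ≤ n, h (p i) = 0 := fun i => by
    induction i using Nat.strong_induction_on with
    | _ i ih =>
      intro hi
      rcases i with _ | i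
      · rw [hp0]
        exact h2 b hab.symm hb
      · have hz : (h ᵥ* C) (p i) = 0 := by
          rcases hpS i hi with hib | hiS
          · rw [hib, ← h4, h0]
          · exact h3 _ hiS
        rw [vecMul, dotProduct, Finset.sum_eq_single (p (i + 1))] at hz
        · exact (mul_eq_zero.1 hz).resolve_right (hne i hi)
        · intro r _ hr
          by_cases hrp : ∃ j ≤ i, r = p j
          · obtain ⟨j, hj, rfl⟩ := hrp
            rw [ih j (by omega) (by omega), zero_mul]
          · push Not at hrp
            by_cases hrS : r = a ∨ r ∈ S
            · rw [hzero i hi r hrS hr hrp, mul_zero]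
            · push Not at hrS
              rw [h2 r hrS.1 hrS.2, zero_mul]
        · simp
  have := key n le_rfl
  rw [hpn, h1] at this
  exact one_ne_zero this

end PartialCovariance
namespace ADMG

/-! ### The district and Markov blanket among the ancestors -/

section AncestralDistrict

variable {V : Type*} (G : ADMG V)

theorem mem_ancestralDistrict_self (b : V) : b ∈ G.ancestralDistrict b :=
  ⟨⟨b, G.mem_ancestors_self b⟩, Relation.ReflTransGen.refl, rfl⟩

variable {G} {b : V}

theorem ancestralDistrict_subset : G.ancestralDistrict b ⊆ G.ancestors b := by
  rintro _ ⟨x, -, rfl⟩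
  exact x.2

theorem mem_ancestralDistrict_of_bidir {u v : V} (hu : u ∈ G.ancestralDistrict b)
    (huv : G.bidir u v) (hv : v ∈ G.ancestors b) : v ∈ G.ancestralDistrict b := by
  obtain ⟨x, hx, rfl⟩ := hu
  exact ⟨⟨v, hv⟩, Relation.ReflTransGen.tail hx huv, rfl⟩

/-- Induction along a bidirected path in the ancestral subgraph. -/
theorem ancestralDistrict_induction {P : V → Prop} (hb : P b)
    (h : ∀ u v, u ∈ G.ancestors b → v ∈ G.ancestors b → G.bidir u v → P u → P v) {d : V}
    (hd : d ∈ G.ancestralDistrict b) : P d := by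
  obtain ⟨x, hx, rfl⟩ := hd
  exact Relation.ReflTransGen.rec (motive := fun x _ => P x.1) hb
    (fun {u v} _ huv ih => h u.1 v.1 u.2 v.2 huv ih) hx

theorem mem_ancestors_of_dir {u v : V} (huv : G.dir u v) (hv : v ∈ G.ancestors b) :
    u ∈ G.ancestors b :=
  Relation.ReflTransGen.head huv hv

theorem not_dir_of_mem_ancestors {v : V} (hv : v ∈ G.ancestors b) : ¬ G.dir b v := fun h =>
  G.acyclic b (Relation.TransGen.head' h hv)

theorem mem_ancestralMarkovBlanket {v : V} : v ∈ G.ancestralMarkovBlanket b ↔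
    (∃ d ∈ G.ancestralDistrict b, G.dir v d) ∨ v ∈ G.ancestralDistrict b ∧ v ≠ b := by
  constructor
  · rintro ⟨x, hx | ⟨hx, hxb⟩, rfl⟩
    · simp only [parentsOf, Set.mem_iUnion] at hx
      obtain ⟨d, hd, hxd⟩ := hx
      exact Or.inl ⟨d, ⟨d, hd, rfl⟩, hxd⟩
    · exact Or.inr ⟨⟨x, hx, rfl⟩, fun h => hxb (Subtype.ext h)⟩
  · rintro (⟨_, ⟨d, hd, rfl⟩, hvd⟩ | ⟨⟨x, hx, rfl⟩, hxb⟩)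
    · refine ⟨⟨v, mem_ancestors_of_dir hvd d.2⟩, Or.inl ?_, rfl⟩
      simp only [parentsOf, Set.mem_iUnion]
      exact ⟨d, hd, hvd⟩
    · exact ⟨x, Or.inr ⟨hx, fun h => hxb (congrArg Subtype.val h)⟩, rfl⟩

end AncestralDistrict

/-! ### Sufficiency -/

section Identification

variable {V : Type*} [Fintype V] [DecidableEq V] {G : ADMG V} {a b : V}

/-- Regression on the Markov blanket in the ancestral subgraph identifies the coefficient. -/
theorem regressionIdentifiesBy_ancestralMarkovBlanket (hab : G.dir a b)
    (haD : a ∉ G.ancestralDistrict b)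
    (hdir : ∀ d ∈ G.ancestralDistrict b, d ≠ b → ¬ G.dir a d) :
    G.RegressionIdentifiesBy a b (G.ancestralMarkovBlanket b \ {a}).toFinite.toFinset := by
  have hbM : b ∉ G.ancestralMarkovBlanket b := by
    rw [mem_ancestralMarkovBlanket]
    rintro (⟨d, hd, hbd⟩ | ⟨-, h⟩)
    · exact not_dir_of_mem_ancestors (ancestralDistrict_subset hd) hbd
    · exact h rfl
  have hne : a ≠ b := fun h => haD (h ▸ G.mem_ancestralDistrict_self b)
  have haS : a ∉ (G.ancestralMarkovBlanket b \ {a}).toFinite.toFinset := by simp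
  refine regressionIdentifiesBy_iff.2 ⟨haS, by simp [hbM], fun θ => ?_⟩
  -- Here the regression is among the errors: of ε_b on the rest of its district.
  obtain ⟨z, hzb, hz0, hzD, -⟩ := exists_partialCov_eq_vecMul θ.errorCov_posDef (a := b)
    (S := (G.ancestralDistrict b \ {b}).toFinite.toFinset) (by simp)
  have hz0' : ∀ v, v ∉ G.ancestralDistrict b → z v = 0 := fun v hv =>
    hz0 v (fun h => hv (h ▸ G.mem_ancestralDistrict_self b)) (by simp [hv])
  have hsymm : z ᵥ* θ.errorCov = θ.errorCov *ᵥ z := by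
    have : θ.errorCovᵀ = θ.errorCov := by
      simpa [conjTranspose_eq_transpose_of_trivial] using θ.errorCov_posDef.isHermitian.eq
    rw [← mulVec_transpose, this]
  have hΩ : ∀ v ∈ G.ancestors b, v ≠ b → (θ.errorCov *ᵥ z) v = 0 := fun v hv hvb => by
    by_cases hvD : v ∈ G.ancestralDistrict b
    · rw [← hsymm]
      exact hzD v (by simp [hvD, hvb])
    · refine Finset.sum_eq_zero fun u _ => ?_
      beta_reduce
      by_cases huD : u ∈ G.ancestralDistrict b
      · rw [θ.errorCov_eq_zero v u (fun h => hvD (h ▸ huD)) fun h =>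
          hvD (mem_ancestralDistrict_of_bidir huD (G.bidir_symm h) hv), zero_mul]
      · rw [hz0' u huD, mul_zero]
  set y := (1 - θ.coeff) *ᵥ z with hy
  have hyv : ∀ v, y v = z v - ∑ w, θ.coeff v w * z w := fun v => by
    rw [hy, sub_mulVec, one_mulVec]
    rfl
  have hq : ∀ v, (θ.cov *ᵥ y) v = ∑ u, θ.coeff u v * (θ.cov *ᵥ y) u + (θ.errorCov *ᵥ z) v :=
    fun v => by
      have : (1 - θ.coeff)ᵀ *ᵥ (θ.cov *ᵥ y) = θ.errorCov *ᵥ z := by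
        rw [hy, mulVec_mulVec, mulVec_mulVec, ← θ.one_sub_coeff_transpose_mul_cov_mul,
          Matrix.mul_assoc]
      rw [← this, transpose_sub, transpose_one, sub_mulVec, one_mulVec]
      change _ = _ + ((θ.cov *ᵥ y) v - ∑ u, θ.coeff u v * (θ.cov *ᵥ y) u)
      ring
  -- The recursion `hq` passes from parents to children and is never fed by b, since b is no parent
  -- of an ancestor of b.
  have hq0 : ∀ v ∈ G.ancestors b, v ≠ b → (θ.cov *ᵥ y) v = 0 := fun v =>
    G.wellFounded_dir.induction
      (C := fun v => v ∈ G.ancestors b → v ≠ b → (θ.cov *ᵥ y) v = 0) v fun v ih hv hvb => by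
        rw [hq, hΩ v hv hvb, add_zero]
        refine Finset.sum_eq_zero fun u _ => ?_
        by_cases huv : G.dir u v
        · rw [ih u huv (mem_ancestors_of_dir huv hv)
            fun h => not_dir_of_mem_ancestors hv (h ▸ huv), mul_zero]
        · rw [θ.coeff_eq_zero u v huv, zero_mul]
  have hsum : ∀ v, (∀ d ∈ G.ancestralDistrict b, ¬ G.dir v d) → ∑ w, θ.coeff v w * z w = 0 :=
    fun v hv => Finset.sum_eq_zero fun w _ => by
      by_cases hw : w ∈ G.ancestralDistrict b
      · rw [θ.coeff_eq_zero v w (hv w hw), zero_mul]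
      · rw [hz0' w hw, mul_zero]
  have hya : y a = - θ.coeff a b := by
    rw [hyv, hz0' a haD, Finset.sum_eq_single b, hzb, mul_one, zero_sub]
    · intro w _ hwb
      by_cases hw : w ∈ G.ancestralDistrict b
      · rw [θ.coeff_eq_zero a w (hdir w hw hwb), zero_mul]
      · rw [hz0' w hw, mul_zero]
    · simp
  rw [partialRegCoeff_eq_neg θ.posDef_cov haS hne (y := y), hya, neg_neg]
  · intro v hva hvb hvS
    have hvM : v ∉ G.ancestralMarkovBlanket b := fun h => hvS (by simp [h, hva])
    rw [mem_ancestralMarkovBlanket] at hvM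
    push Not at hvM
    rw [hyv, hz0' v fun h => hvb (hvM.2 h), hsum v hvM.1, sub_zero]
  · rw [hyv, hzb, hsum b fun d hd => not_dir_of_mem_ancestors (ancestralDistrict_subset hd),
      sub_zero]
  · exact hq0 a (mem_ancestors_of_dir hab (G.mem_ancestors_self b)) hne
  · intro s hs
    have hsM : s ∈ G.ancestralMarkovBlanket b := by
      simp only [Set.Finite.mem_toFinset, Set.mem_sdiff] at hs
      exact hs.1
    refine hq0 s ?_ fun h => hbM (h ▸ hsM)
    rcases mem_ancestralMarkovBlanket.1 hsM with ⟨d, hd, hsd⟩ | ⟨hd, -⟩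
    · exact mem_ancestors_of_dir hsd (ancestralDistrict_subset hd)
    · exact ancestralDistrict_subset hd

end Identification

end ADMG
-- Necessity: path-shaped error covariances and forests
/-- A positive definite matrix whose off-diagonal support is a prescribed symmetric relation. -/
theorem exists_posDef_offDiag {V : Type*} [Fintype V] [DecidableEq V] (E : V → V → Prop)
    (hE : ∀ u v, E u v → E v u) :
    ∃ W : Matrix V V ℝ, W.PosDef ∧ (∀ u v, u ≠ v → E u v → W u v = -1) ∧
      ∀ u v, u ≠ v → ¬ E u v → W u v = 0 := by
  classical
  let H : SimpleGraph V :=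
    { Adj := fun u v => u ≠ v ∧ E u v
      symm := ⟨fun _ _ h => ⟨h.1.symm, hE _ _ h.2⟩⟩
      loopless := ⟨fun _ h => h.1 rfl⟩ }
  -- Identity plus graph Laplacian; all off-diagonal entries are nonpositive, which later excludes
  -- cancellation in class sums.
  refine ⟨1 + H.lapMatrix ℝ, PosDef.one.add_posSemidef (H.posSemidef_lapMatrix ℝ), ?_, ?_⟩
  · intro u v huv h
    have : H.Adj u v := ⟨huv, h⟩
    simp [SimpleGraph.lapMatrix, SimpleGraph.degMatrix, huv, this]
  · intro u v huv h
    have : ¬ H.Adj u v := fun h' => h h'.2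
    simp [SimpleGraph.lapMatrix, SimpleGraph.degMatrix, huv, this]

/-- Two vertices are linked by consecutive steps of a path. -/
def PathLinked {V : Type*} (p : ℕ → V) (n : ℕ) (r r' : V) : Prop :=
  ∃ i < n, (r = p i ∧ r' = p (i + 1)) ∨ (r = p (i + 1) ∧ r' = p i)

theorem PathLinked.symm {V : Type*} {p : ℕ → V} {n : ℕ} {r r' : V} (h : PathLinked p n r r') :
    PathLinked p n r' r := by
  obtain ⟨i, hi, h | h⟩ := h
  · exact ⟨i, hi, Or.inr h.symm⟩
  · exact ⟨i, hi, Or.inl h.symm⟩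

theorem PathLinked.eq_of_right {V : Type*} {p : ℕ → V} {n : ℕ}
    (hp : Set.InjOn p {i | i ≤ n}) {i : ℕ} (hi : i ≤ n) {r : V} (h : PathLinked p n r (p i)) :
    (∃ j ≤ i, r = p j) ∨ (i < n ∧ r = p (i + 1)) := by
  obtain ⟨j, hj, ⟨h1, h2⟩ | ⟨h1, h2⟩⟩ := h
  · have : i = j + 1 := hp hi (show j + 1 ≤ n by omega) h2
    exact Or.inl ⟨j, by omega, h1⟩
  · have : i = j := hp hi (show j ≤ n by omega) h2
    subst this
    exact Or.inr ⟨hj, h1⟩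

namespace ADMG

section RootGraph

variable {V : Type*} {G : ADMG V} {b : V}

/-- The graph on roots in which two roots are adjacent if a bidirected edge between ancestors of
`b` joins their classes. -/
def rootGraph (G : ADMG V) (b : V) (root : V → V) : SimpleGraph V where
  Adj r r' := r ≠ r' ∧ ∃ u ∈ G.ancestors b, ∃ v ∈ G.ancestors b,
    G.bidir u v ∧ root u = r ∧ root v = r'
  symm := ⟨fun _ _ h => by
    obtain ⟨hne, u, hu, v, hv, huv, h1, h2⟩ := h
    exact ⟨hne.symm, v, hv, u, hu, G.bidir_symm huv, h2, h1⟩⟩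
  loopless := ⟨fun _ h => h.1 rfl⟩

/-- Under `root`, each bidirected edge between ancestors becomes an edge or collapses to a vertex.
-/
theorem rootGraph_reachable {root : V → V} (hb : root b = b) {d : V}
    (hd : d ∈ G.ancestralDistrict b) : (G.rootGraph b root).Reachable b (root d) := by
  refine ancestralDistrict_induction (P := fun d => (G.rootGraph b root).Reachable b (root d))
    (by rw [hb]) (fun u v hu hv huv h => ?_) hd
  by_cases hne : root u = root v
  · rwa [← hne]
  · exact h.trans (SimpleGraph.Adj.reachable ⟨hne, u, hu, v, hv, huv, rfl, rfl⟩)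

end RootGraph

variable {V : Type*} [Fintype V] {G : ADMG V} {a b : V}

/-- Following a chosen outgoing edge from each ancestor of `b` outside `T` leads to a root
in `T`. -/
theorem exists_next_root (G : ADMG V) {b : V} {T : Set V} (hb : b ∈ T) :
    ∃ next root : V → V, (∀ u ∈ G.ancestors b \ T, G.dir u (next u)) ∧
      (∀ u ∉ G.ancestors b \ T, root u = u) ∧
      (∀ u ∈ G.ancestors b \ T, root u = root (next u)) ∧
      ∀ u ∈ G.ancestors b, root u ∈ T := by
  classical
  have h : ∀ u, ∃ v, u ∈ G.ancestors b \ T → G.dir u v ∧ v ∈ G.ancestors b := fun u => by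
    by_cases hu : u ∈ G.ancestors b \ T
    · rcases Relation.ReflTransGen.cases_head hu.1 with rfl | ⟨v, huv, hv⟩
      · exact absurd hb hu.2
      · exact ⟨v, fun _ => ⟨huv, hv⟩⟩
    · exact ⟨u, fun h => absurd h hu⟩
  choose next hnext using h
  -- The recursion runs from a vertex to its chosen child; vertices outside the domain are their own
  -- roots.
  let F : (u : V) → ((v : V) → G.dir u v → V) → V := fun u f =>
    if hu : u ∈ G.ancestors b \ T then f (next u) (hnext u hu).1 else u
  let root : V → V := G.wellFounded_swap_dir.fix F
  have hroot : ∀ u, root u = if u ∈ G.ancestors b \ T then root (next u) else u := fun u => by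
    change G.wellFounded_swap_dir.fix F u = _
    rw [WellFounded.fix_eq]
    by_cases hu : u ∈ G.ancestors b \ T
    · rw [if_pos hu]
      exact dif_pos hu
    · rw [if_neg hu]
      exact dif_neg hu
  refine ⟨next, root, fun u hu => (hnext u hu).1, fun u hu => by rw [hroot, if_neg hu],
    fun u hu => by rw [hroot, if_pos hu], fun u => ?_⟩
  refine G.wellFounded_swap_dir.induction (C := fun u => u ∈ G.ancestors b → root u ∈ T) u ?_
  intro u ih hu
  by_cases huT : u ∈ G.ancestors b \ T
  · rw [hroot, if_pos huT]
    exact ih _ (hnext u huT).1 (hnext u huT).2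
  · rw [hroot, if_neg huT]
    by_contra h
    exact huT ⟨hu, h⟩

/-- The covariance of two classes of errors with covariance matrix `W`. -/
noncomputable def classCov [DecidableEq V] (W : Matrix V V ℝ) (root : V → V) (r r' : V) : ℝ :=
  (fun u => if root u = r then 1 else 0) ⬝ᵥ (W *ᵥ fun u => if root u = r' then 1 else 0)

/-- Error covariances for which the class covariances are tridiagonal along a path. -/
theorem exists_errorCov_of_path [DecidableEq V] (G : ADMG V) (root : V → V) (p : ℕ → V) (n : ℕ)
    (hp : ∀ i < n, (G.rootGraph b root).Adj (p i) (p (i + 1))) :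
    ∃ W : Matrix V V ℝ, W.PosDef ∧ (∀ i j, i ≠ j → ¬ G.bidir i j → W i j = 0) ∧
      (∀ i < n, classCov W root (p (i + 1)) (p i) ≠ 0) ∧
      (∀ r r', r ≠ r' → ¬ PathLinked p n r r' → classCov W root r r' = 0) ∧
      ∀ r, root r = r → 0 < classCov W root r r := by
  obtain ⟨W, hW, hW1, hW0⟩ := exists_posDef_offDiag
    (fun u v => G.bidir u v ∧ PathLinked p n (root u) (root v))
    (fun u v h => ⟨G.bidir_symm h.1, h.2.symm⟩)
  have hsum : ∀ r r', classCov W root r r' =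
      ∑ u, ∑ v, if root u = r ∧ root v = r' then W u v else 0 := fun r r' => by
    refine Finset.sum_congr rfl fun u _ => ?_
    simp only [mulVec, dotProduct, Finset.mul_sum]
    refine Finset.sum_congr rfl fun v _ => ?_
    by_cases h1 : root u = r <;> by_cases h2 : root v = r' <;> simp [h1, h2]
  refine ⟨W, hW, fun i j hij h => hW0 i j hij fun h' => h h'.1, ?_, ?_, ?_⟩
  · intro i hi
    obtain ⟨hne, u, -, v, -, huv, hu, hv⟩ := hp i hi
    refine ne_of_lt ?_
    rw [hsum]
    have hle : ∀ x y, (if root x = p (i + 1) ∧ root y = p i then W x y else 0) ≤ 0 :=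
      fun x y => by
        split_ifs with h
        · have hxy : x ≠ y := fun hxy => hne (by rw [← h.1, ← h.2, hxy])
          by_cases hE : G.bidir x y ∧ PathLinked p n (root x) (root y)
          · rw [hW1 x y hxy hE]
            norm_num
          · rw [hW0 x y hxy hE]
        · exact le_rfl
    refine Finset.sum_neg' (fun x _ => Finset.sum_nonpos fun y _ => hle x y)
      ⟨v, Finset.mem_univ v, Finset.sum_neg' (fun y _ => hle v y) ⟨u, Finset.mem_univ u, ?_⟩⟩
    rw [if_pos ⟨hv, hu⟩, hW1 v u]
    · norm_num
    · rintro rfl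
      exact G.bidir_irrefl _ huv
    · exact ⟨G.bidir_symm huv, by rw [hu, hv]; exact ⟨i, hi, Or.inr ⟨rfl, rfl⟩⟩⟩
  · intro r r' hne h
    rw [hsum]
    refine Finset.sum_eq_zero fun u _ => Finset.sum_eq_zero fun v _ => ?_
    split_ifs with hr
    · refine hW0 u v (fun huv => hne (by rw [← hr.1, ← hr.2, huv])) fun h' => h ?_
      rw [← hr.1, ← hr.2]
      exact h'.2
    · rfl
  · intro r hr
    have hne : (fun u => if root u = r then (1 : ℝ) else 0) ≠ 0 := fun h0 => by
      simpa [hr] using congrFun h0 r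
    simpa [classCov] using hW.dotProduct_mulVec_pos hne

/-- Parameters with coefficient one on the edges of a forest and coefficient `κ` on one further
edge `a → d`, and the resulting covariances of the roots. -/
theorem exists_parameters_of_forest [DecidableEq V] {N : Set V} {next root : V → V}
    (hnext : ∀ u ∈ N, G.dir u (next u)) (hroot : ∀ u ∉ N, root u = u)
    (hroot' : ∀ u ∈ N, root u = root (next u)) (haN : a ∉ N)
    {W : Matrix V V ℝ} (hW : W.PosDef) (hW0 : ∀ i j, i ≠ j → ¬ G.bidir i j → W i j = 0)
    (κ : ℝ) (d : V) (hκ : κ = 0 ∨ G.dir a d ∧ d ≠ b) :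
    ∃ θ : G.SEMParameters, θ.coeff a b = 0 ∧ ∀ r ∉ N, ∀ r' ∉ N,
      classCov W root r r' = θ.cov r r' - (if root d = r then κ * θ.cov a r' else 0)
        - (if root d = r' then κ * θ.cov r a else 0)
        + (if root d = r ∧ root d = r' then κ ^ 2 * θ.cov a a else 0) := by
  classical
  let θ : G.SEMParameters :=
    { coeff := Matrix.of fun u v =>
        (if u ∈ N ∧ v = next u then 1 else 0) + (if u = a ∧ v = d then κ else 0)
      errorCov := W
      errorCov_posDef := hW
      errorCov_eq_zero := hW0
      coeff_eq_zero := fun u v huv => by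
        have h1 : ¬ (u ∈ N ∧ v = next u) := fun h => huv (h.2 ▸ hnext u h.1)
        rw [of_apply, if_neg h1, zero_add]
        split_ifs with h
        · rcases hκ with h0 | h0
          · exact h0
          · exact absurd (h.1 ▸ h.2 ▸ h0.1) huv
        · rfl }
  -- Applied to a class indicator, `1 - Λ` telescopes along the forest: only the root survives,
  -- apart from the contribution of a → d.
  have hcls : ∀ r ∉ N, (1 - θ.coeff) *ᵥ (fun u => if root u = r then 1 else 0) =
      Pi.single r 1 - (if root d = r then κ else 0) • Pi.single a 1 := by
    intro r hr
    funext u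
    rw [sub_mulVec, one_mulVec, Pi.sub_apply]
    have hrow : (θ.coeff *ᵥ fun u => if root u = r then 1 else 0) u =
        (if u ∈ N then if root (next u) = r then 1 else 0 else 0) +
          if u = a then if root d = r then κ else 0 else 0 := by
      simp only [mulVec, dotProduct, θ, of_apply, add_mul, Finset.sum_add_distrib]
      congr 1
      · by_cases hu : u ∈ N <;> simp only [hu, true_and, false_and, if_true, if_false, ite_mul,
          one_mul, zero_mul, Finset.sum_ite_eq', Finset.mem_univ, Finset.sum_const_zero]
      · by_cases hu : u = a
        · by_cases hr : root d = r <;> simp only [hu, hr, true_and, if_true, if_false, ite_mul,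
            zero_mul, Finset.sum_ite_eq', Finset.mem_univ, mul_one, mul_zero]
        · simp [hu]
    have hua : (if u = a then if root d = r then κ else 0 else 0) =
        ((if root d = r then κ else 0) • Pi.single a 1 : V → ℝ) u := by
      by_cases hu : u = a
      · subst hu
        simp
      · simp [hu]
    rw [hrow, Pi.sub_apply, hua, ← sub_sub]
    congr 1
    by_cases hu : u ∈ N
    · have hur : u ≠ r := fun h => hr (h ▸ hu)
      simp [hu, hroot' u hu, hur]
    · by_cases hur : u = r
      · subst hur
        simp [hu, hroot u hu]
      · simp [hu, hroot u hu, hur]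
  refine ⟨θ, ?_, fun r hr r' hr' => ?_⟩
  · change (if a ∈ N ∧ b = next a then (1 : ℝ) else 0) + (if a = a ∧ b = d then κ else 0) = 0
    rw [if_neg fun h => haN h.1, zero_add]
    split_ifs with h
    · exact hκ.resolve_right fun h' => h'.2 h.2.symm
    · rfl
  · have : classCov W root r r' =
        ((1 - θ.coeff) *ᵥ fun u => if root u = r then (1 : ℝ) else 0) ⬝ᵥ
          (θ.cov *ᵥ ((1 - θ.coeff) *ᵥ fun u => if root u = r' then (1 : ℝ) else 0)) := by
      rw [classCov, show W = θ.errorCov from rfl, ← θ.one_sub_coeff_transpose_mul_cov_mul,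
        ← mulVec_mulVec, ← mulVec_mulVec, dotProduct_mulVec _ (1 - θ.coeff)ᵀ, vecMul_transpose]
    rw [this, hcls r hr, hcls r' hr']
    simp only [mulVec_sub, mulVec_smul, dotProduct_sub, sub_dotProduct, smul_dotProduct,
      dotProduct_smul, mulVec_single_one, single_one_dotProduct, col_apply, smul_eq_mul]
    simp only [ite_and]
    split_ifs <;> ring

variable [DecidableEq V]

/-- A partial covariance given `S` does not vanish identically on the parameters with coefficient
zero on `a → b` if the district of `b` in the ancestral subgraph contains `a` or a further child
of `a`. -/
theorem exists_partialCov_ne_zero {S : Finset V} (ha : a ∉ S) (hb : b ∉ S) (hab : G.dir a b)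
    {d : V} (hd : d ∈ G.ancestralDistrict b) (had : d = a ∨ G.dir a d ∧ d ≠ b) :
    ∃ θ : G.SEMParameters, θ.coeff a b = 0 ∧ partialCov θ.cov a b S ≠ 0 := by
  have hne : a ≠ b := fun h => G.acyclic a (Relation.TransGen.single (h ▸ hab))
  set T : Set V := {v | v = a ∨ v = b ∨ v ∈ S} with hT
  have haT : a ∈ T := Or.inl rfl
  have hbT : b ∈ T := Or.inr (Or.inl rfl)
  obtain ⟨next, root, hnext, hroot, hroot', hrootT⟩ := G.exists_next_root hbT
  have hTN : ∀ v ∈ T, v ∉ G.ancestors b \ T := fun v hv h => h.2 hv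
  have hroota : root a = a := hroot a (hTN a haT)
  have hrootb : root b = b := hroot b (hTN b hbT)
  have hpT : ∀ e ∈ T, ∀ (w : (G.rootGraph b root).Walk b e), ∀ i ≤ w.length, w.getVert i ∈ T := by
    intro e _ w i hi
    rcases i with _ | i
    · rwa [w.getVert_zero]
    · obtain ⟨-, u, -, v, hv, -, -, h⟩ := w.adj_getVert_succ (i := i) (by omega)
      exact h ▸ hrootT v hv
  by_cases hba : (G.rootGraph b root).Reachable b a
  · obtain ⟨w, hw⟩ := hba.exists_isPath
    have hinj := hw.getVert_injOn
    obtain ⟨W, hW, hW0, hlink, hzero, -⟩ :=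
      G.exists_errorCov_of_path root w.getVert w.length fun i hi => w.adj_getVert_succ hi
    -- With κ = 0 the extra edge is absent, and the argument `a` in place of d is a dummy.
    obtain ⟨θ, hθ, hcov⟩ := exists_parameters_of_forest (a := a) (b := b) hnext hroot hroot'
      (hTN a haT) hW hW0 0 a (Or.inl rfl)
    have hcov' : ∀ r ∈ T, ∀ r' ∈ T, θ.cov r r' = classCov W root r r' := fun r hr r' hr' => by
      simp [hcov r (hTN r hr) r' (hTN r' hr')]
    refine ⟨θ, hθ, partialCov_ne_zero_of_path θ.posDef_cov ha w.getVert w.length w.getVert_zero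
      w.getVert_length (fun i hi => ?_) (fun i hi => ?_) (fun i hi r hr hr1 hr2 => ?_) hne hb⟩
    · refine (hpT a haT w i hi.le).resolve_left fun h => ?_
      have := hinj (show i ≤ w.length from hi.le) (show w.length ≤ w.length from le_rfl)
        (h.trans w.getVert_length.symm)
      omega
    · rw [hcov' _ (hpT a haT w _ hi) _ (hpT a haT w _ hi.le)]
      exact hlink i hi
    · rw [hcov' r (hr.imp_right Or.inr) _ (hpT a haT w _ hi.le)]
      refine hzero _ _ (hr2 i le_rfl) fun h => ?_
      rcases h.eq_of_right hinj hi.le with ⟨j, hj, h⟩ | ⟨-, h⟩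
      · exact hr2 j hj h
      · exact hr1 h
  · have hbd := rootGraph_reachable hrootb hd
    have hda : G.dir a d ∧ d ≠ b := had.resolve_left fun h => hba (hroota ▸ h ▸ hbd)
    have hrda : root d ≠ a := fun h => hba (h ▸ hbd)
    have hrdT : root d ∈ T := hrootT d (ancestralDistrict_subset hd)
    obtain ⟨w, hw⟩ := hbd.exists_isPath
    have hinj := hw.getVert_injOn
    have hwa : ∀ i, w.getVert i ≠ a := fun i h => hba (h ▸ (w.take i).reachable)
    obtain ⟨W, hW, hW0, hlink, hzero, hpos⟩ :=
      G.exists_errorCov_of_path root w.getVert w.length fun i hi => w.adj_getVert_succ hi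
    obtain ⟨θ, hθ, hcov⟩ := exists_parameters_of_forest (a := a) (b := b) hnext hroot hroot'
      (hTN a haT) hW hW0 1 d (Or.inr hda)
    -- The path avoids a, so the class of a is uncorrelated with all others; a enters only through a
    -- → d.
    have hza : ∀ r, r ≠ a → classCov W root r a = 0 ∧ classCov W root a r = 0 := fun r hr => by
      have hL : ¬ PathLinked w.getVert w.length r a := by
        rintro ⟨i, -, ⟨-, h⟩ | ⟨-, h⟩⟩
        · exact hwa _ h.symm
        · exact hwa _ h.symm
      exact ⟨hzero r a hr hL, hzero a r hr.symm fun h => hL h.symm⟩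
    have hcov' : ∀ r ∈ T, ∀ r' ∈ T, root d ≠ r → root d ≠ r' →
        θ.cov r r' = classCov W root r r' := fun r hr r' hr' h1 h2 => by
      simp [hcov r (hTN r hr) r' (hTN r' hr'), h1, h2]
    have hcova : ∀ r ∈ T, root d ≠ r → r ≠ a → θ.cov a r = 0 ∧ θ.cov r a = 0 :=
      fun r hr h1 h2 => by
        rw [hcov' a haT r hr hrda h1, hcov' r hr a haT h1 hrda]
        exact (hza r h2).symm
    have hlast : ∀ i < w.length, root d ≠ w.getVert i := fun i hi h => by
      have := hinj (show i ≤ w.length from hi.le) (show w.length ≤ w.length from le_rfl)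
        (h.symm.trans w.getVert_length.symm)
      omega
    have hpath : ∀ i < w.length, ∀ r ∈ T, θ.cov r (w.getVert i) = classCov W root r (w.getVert i) :=
      fun i hi r hr => by
        have hiT := hpT _ hrdT w i hi.le
        rw [hcov r (hTN r hr) _ (hTN _ hiT)]
        simp [hlast i hi, (hcova _ hiT (hlast i hi) (hwa i)).1]
    -- The path of roots is prolonged by one step, from the root of d to a.
    set p : ℕ → V := fun i => if i ≤ w.length then w.getVert i else a with hp
    have hple : ∀ i ≤ w.length, p i = w.getVert i := fun i hi => if_pos hi
    have hplast : p (w.length + 1) = a := if_neg (by omega)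
    refine ⟨θ, hθ, partialCov_ne_zero_of_path θ.posDef_cov ha p (w.length + 1)
      ((hple 0 (by omega)).trans w.getVert_zero) hplast
      (fun i hi => ?_) (fun i hi => ?_) (fun i hi r hr hr1 hr2 => ?_) hne hb⟩
    · rw [hple i (by omega)]
      exact (hpT _ hrdT w i (by omega)).resolve_left (hwa i)
    · rcases (Nat.lt_succ_iff.1 hi).lt_or_eq with hi | rfl
      · rw [hple _ hi, hple _ hi.le, hpath i hi _ (hpT _ hrdT w _ hi)]
        exact hlink i hi
      · rw [hplast, hple _ le_rfl, w.getVert_length]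
        have h1 := hcov a (hTN a haT) _ (hTN _ hrdT)
        have h2 := hcov' a haT a haT hrda hrda
        rw [(hza _ hrda).2] at h1
        simp only [hrda, if_false, false_and, if_true, one_mul, sub_zero, add_zero] at h1
        rw [← sub_eq_zero.1 h1.symm] at h2
        rw [h2]
        exact (hpos a hroota).ne'
    · have hrT : r ∈ T := hr.imp_right Or.inr
      have hri := hr2 i le_rfl
      rcases (Nat.lt_succ_iff.1 hi).lt_or_eq with hi | rfl
      · rw [hple _ hi.le] at hri ⊢
        rw [hple _ hi] at hr1
        rw [hpath i hi r hrT]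
        refine hzero _ _ hri fun h => ?_
        rcases h.eq_of_right hinj hi.le with ⟨j, hj, h⟩ | ⟨-, h⟩
        · exact hr2 j hj (h.trans (hple j (by omega)).symm)
        · exact hr1 h
      · rw [hplast] at hr1
        rw [hple _ le_rfl, w.getVert_length] at hri ⊢
        have h1 := hcov r (hTN r hrT) _ (hTN _ hrdT)
        simp only [hri.symm, if_false, false_and, if_true, one_mul, sub_zero, add_zero,
          (hcova r hrT hri.symm hr1).2] at h1
        rw [← h1]
        refine hzero _ _ hri fun h => ?_
        nth_rewrite 3 [← w.getVert_length] at h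
        rcases h.eq_of_right hinj le_rfl with ⟨j, hj, h⟩ | ⟨h, -⟩
        · exact hr2 j hj (h.trans (hple j hj).symm)
        · omega

end ADMG

theorem mainTheorem1 {V : Type*} [Fintype V] [DecidableEq V] (G : ADMG V) (a b : V)
    (hab : G.dir a b) :
    (G.RegressionIdentifiable a b ↔
      (a ∉ G.ancestralDistrict b ∧ ∀ d ∈ G.ancestralDistrict b, d ≠ b → ¬ G.dir a d)) ∧
    ((a ∉ G.ancestralDistrict b ∧ ∀ d ∈ G.ancestralDistrict b, d ≠ b → ¬ G.dir a d) →
      G.RegressionIdentifiesBy a b (G.ancestralMarkovBlanket b \ {a}).toFinite.toFinset) := by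
  have hsuff := fun h : a ∉ G.ancestralDistrict b ∧
      ∀ d ∈ G.ancestralDistrict b, d ≠ b → ¬ G.dir a d =>
    ADMG.regressionIdentifiesBy_ancestralMarkovBlanket hab h.1 h.2
  refine ⟨⟨?_, fun h => ⟨_, hsuff h⟩⟩, hsuff⟩
  rintro ⟨S, hS⟩
  obtain ⟨ha, hb, hS⟩ := ADMG.regressionIdentifiesBy_iff.1 hS
  have key : ∀ d ∈ G.ancestralDistrict b, ¬ (d = a ∨ G.dir a d ∧ d ≠ b) := fun d hd had => by
    -- Here λ_ab = 0 while β_{ab·S} ≠ 0.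
    obtain ⟨θ, hθ, hpc⟩ := ADMG.exists_partialCov_ne_zero ha hb hab hd had
    have h := hS θ
    rw [hθ, partialRegCoeff] at h
    exact div_ne_zero hpc (partialCov_self_pos θ.posDef_cov ha).ne' h.symm
  exact ⟨fun h => key a h (Or.inl rfl), fun d hd hdb had => key d hd (Or.inr ⟨had, hdb⟩)⟩
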